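/- Let $M$ be a flat para-Kähler (flat bi-Lagrangian) double manifold of dimension $2m$, i.e. a (Hausdorff) manifold with an atlas of distinguished coordinates $(x^i,\tilde x_i)_{i=1,\dots,m}$ whose coordinate changes are locally of the form $x^i=\alpha^i_jx'^j+\alpha^i_0$, $\tilde x_i=\beta_i^k\tilde x'_k+\beta_i^0$ with constants satisfying $\alpha^i_j\beta_i^k=\delta_j^k$. Let $\gamma$ be the neutral metric of $M$ with $\gamma(\partial/\partial x^i,\partial/\partial\tilde x_j)=\delta_i^j$, $\gamma(\partial/\partial x^i,\partial/\partial x^j)=\gamma(\partial/\partial\tilde x_i,\partial/\partial\tilde x_j)=0$, and let $\nabla^0$ be the flat connection with $\nabla^0(\partial/\partial x^i)=\nabla^0(\partial/\partial\tilde x_j)=0$. For a function $f$ and vector fields $X,Y$ on $M$ (all smooth) define $\partial f$, $X\wedge_{\nabla^0}Y$, the metric bracket and the metric product by $$\gamma(\partial f,Z)=\tfrac12 Zf,\qquad \gamma(Z,X\wedge_{\nabla^0}Y)=\tfrac12\left[\gamma(X,\nabla^0_ZY)-\gamma(Y,\nabla^0_ZX)\right]\quad\text{for all } Z,$$ $$[X,Y]_{\nabla^0}=\nabla^0_XY-\nabla^0_YX-X\wedge_{\nabla^0}Y,\qquad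 X\bigstar Y=[X,Y]_{\nabla^0}+\partial(\gamma(X,Y)).$$ A smooth vector field is strongly foliated if with respect to distinguished coordinates it has the local form $X=\xi^i(x^j)\,\partial/\partial x^i+\tilde\xi_i(x^j)\,\partial/\partial\tilde x_i$. Then the space $\chi_{\rm sf}(M)$ of strongly foliated vector fields is closed under $\bigstar$, and $$X\bigstar(Y\bigstar Z)-(X\bigstar Y)\bigstar Z-Y\bigstar(X\bigstar Z)=0\qquad\text{for all } X,Y,Z\in\chi_{\rm sf}(M).$$ The identity fails on general vector fields: if $m\ge1$ and $M\neq\emptyset$, there are smooth vector fields $X,Y,Z$ on $M$ for which the left-hand side is not identically zero. -/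

import Mathlib

open scoped Manifold ContDiff Matrix Topology

noncomputable section

namespace ParaKahler

/-- The model space `ℝᵐ × ℝᵐ` of the distinguished coordinates `(xⁱ, x̃ᵢ)`: the first component
collects the `xⁱ`, the second one the `x̃ᵢ`. -/
abbrev Model (m : ℕ) : Type := (Fin m → ℝ) × (Fin m → ℝ)

/-- A flat para-Kähler (flat bi-Lagrangian) double manifold of dimension `2m`: the charts of `M` are
distinguished coordinates `(xⁱ, x̃ᵢ)`, and their coordinate changes have the local form
`xⁱ = αⁱⱼ x'ʲ + αⁱ₀`, `x̃ᵢ = βᵢᵏ x̃'ₖ + βᵢ⁰` with constants satisfying `αⁱⱼ βᵢᵏ = δⱼᵏ`. Hence the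
form `ω = dxⁱ ∧ dx̃ᵢ`, the foliations `L` (`x̃ᵢ = const`) and `L̃` (`xⁱ = const`), and the neutral
metric `γ` are well defined on `M`. -/
class IsFlatParaKahler (m : ℕ) (M : Type*) [TopologicalSpace M] [ChartedSpace (Model m) M] :
    Prop where
  affine_change : ∀ e ∈ atlas (Model m) M, ∀ e' ∈ atlas (Model m) M,
    ∀ p ∈ (e.symm ≫ₕ e').source,
      ∃ (α β : Matrix (Fin m) (Fin m) ℝ) (α₀ β₀ : Fin m → ℝ), αᵀ * β = 1 ∧
        ∀ᶠ q in 𝓝 p, (e.symm ≫ₕ e') q = (α *ᵥ q.1 + α₀, β *ᵥ q.2 + β₀)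

/-- The smooth structure defined by the distinguished coordinates. -/
instance isManifold (m : ℕ) (M : Type*) [TopologicalSpace M] [ChartedSpace (Model m) M]
    [IsFlatParaKahler m M] : IsManifold 𝓘(ℝ, Model m) ∞ M := by
  apply isManifold_of_contDiffOn
  intro e e' he he'
  simp only [modelWithCornersSelf_coe, modelWithCornersSelf_coe_symm, Function.comp_id,
    Function.id_comp, Set.preimage_id, Set.range_id, Set.inter_univ]
  intro p hp
  obtain ⟨α, β, α₀, β₀, -, h⟩ := IsFlatParaKahler.affine_change e he e' he' p hp
  refine ContDiffAt.contDiffWithinAt (ContDiffAt.congr_of_eventuallyEq ?_ h)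
  have h1 : ContDiff ℝ ∞ (fun v : Fin m → ℝ => α *ᵥ v) :=
    (LinearMap.toContinuousLinearMap (Matrix.mulVecLin α)).contDiff
  have h2 : ContDiff ℝ ∞ (fun v : Fin m → ℝ => β *ᵥ v) :=
    (LinearMap.toContinuousLinearMap (Matrix.mulVecLin β)).contDiff
  exact (((h1.comp contDiff_fst).add contDiff_const).prodMk
    ((h2.comp contDiff_snd).add contDiff_const)).contDiffAt

/-- The neutral metric of the model space:
`γ(∂/∂xⁱ, ∂/∂x̃ⱼ) = δᵢʲ`, `γ(∂/∂xⁱ, ∂/∂xʲ) = γ(∂/∂x̃ᵢ, ∂/∂x̃ⱼ) = 0`. -/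
def stdMetric (m : ℕ) : LinearMap.BilinForm ℝ (Model m) :=
  LinearMap.mk₂ ℝ (fun u v => u.1 ⬝ᵥ v.2 + u.2 ⬝ᵥ v.1)
    (fun u u' v => by simp only [Prod.fst_add, Prod.snd_add, add_dotProduct]; ring)
    (fun c u v => by simp [smul_dotProduct, mul_add])
    (fun u v v' => by simp only [Prod.fst_add, Prod.snd_add, dotProduct_add]; ring)
    (fun c u v => by simp [dotProduct_smul, mul_add])

lemma stdMetric_nondegenerate (m : ℕ) : (stdMetric m).Nondegenerate := by
  have hl : (stdMetric m).SeparatingLeft := by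
    intro u hu
    apply Prod.ext
    · exact dotProduct_eq_zero u.1 (fun w => by simpa [stdMetric] using hu (0, w))
    · exact dotProduct_eq_zero u.2 (fun w => by simpa [stdMetric] using hu (w, 0))
  refine ⟨hl, fun u hu => hl u fun w => ?_⟩
  have := hu w
  simp only [stdMetric, LinearMap.mk₂_apply] at this ⊢
  rw [dotProduct_comm u.1, dotProduct_comm u.2]
  linarith

variable {m : ℕ} {M : Type*} [TopologicalSpace M] [ChartedSpace (Model m) M]

/-- The components, with respect to the distinguished coordinates `e = (xⁱ, x̃ᵢ)`, of a tangent
vector at `x`. -/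
def comps (e : OpenPartialHomeomorph M (Model m)) (x : M) :
    TangentSpace 𝓘(ℝ, Model m) x →L[ℝ] Model m :=
  mvfderiv 𝓘(ℝ, Model m) e x

lemma comps_chartAt_bijective [IsFlatParaKahler m M] (x : M) :
    Function.Bijective (comps (chartAt (Model m) x) x) :=
  (mdifferentiable_chart (I := 𝓘(ℝ, Model m)) x).mfderiv_bijective (mem_chart_source (Model m) x)

/-- The neutral metric `γ = dxⁱ ⊗ dx̃ᵢ + dx̃ᵢ ⊗ dxⁱ` of `M`. -/
def metric (x : M) : LinearMap.BilinForm ℝ (TangentSpace 𝓘(ℝ, Model m) x) :=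
  (stdMetric m).compl₁₂ (comps (chartAt (Model m) x) x).toLinearMap
    (comps (chartAt (Model m) x) x).toLinearMap

lemma metric_nondegenerate [IsFlatParaKahler m M] (x : M) :
    (metric (m := m) x).Nondegenerate := by
  have hb := comps_chartAt_bijective (m := m) x
  constructor
  · intro u hu
    refine hb.1 ?_
    rw [map_zero]
    refine (stdMetric_nondegenerate m).1 _ fun w => ?_
    obtain ⟨v, rfl⟩ := hb.2 w
    exact hu v
  · intro u hu
    refine hb.1 ?_
    rw [map_zero]
    refine (stdMetric_nondegenerate m).2 _ fun w => ?_
    obtain ⟨v, rfl⟩ := hb.2 w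
    exact hu v

instance (x : M) : FiniteDimensional ℝ (TangentSpace 𝓘(ℝ, Model m) x) :=
  inferInstanceAs (FiniteDimensional ℝ (Model m))

/-- The musical isomorphism `♯_γ : T*ₓM → TₓM`, so that `γ(♯_γ α, v) = α(v)`. -/
def sharp [IsFlatParaKahler m M] (x : M) :
    Module.Dual ℝ (TangentSpace 𝓘(ℝ, Model m) x) ≃ₗ[ℝ] TangentSpace 𝓘(ℝ, Model m) x :=
  ((metric (m := m) x).toDual (metric_nondegenerate x)).symm

/-- The operator `∂ = (1/2) ♯_γ ∘ d` on functions, i.e. `γ(∂f, Z) = (1/2) Z f`. -/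
def partialOp [IsFlatParaKahler m M] (f : M → ℝ) (x : M) : TangentSpace 𝓘(ℝ, Model m) x :=
  (1 / 2 : ℝ) • sharp x (mvfderiv 𝓘(ℝ, Model m) f x).toLinearMap

/-- The canonical flat connection `∇⁰`, for which `∇⁰ ∂/∂xⁱ = 0` and `∇⁰ ∂/∂x̃ⱼ = 0` in distinguished
coordinates: the components of `∇⁰_v Y` at `x`, written `nabla Y x v`, are the derivatives along `v`
of the components of `Y`. -/
def nabla (Y : Π x : M, TangentSpace 𝓘(ℝ, Model m) x) (x : M) :
    TangentSpace 𝓘(ℝ, Model m) x →L[ℝ] TangentSpace 𝓘(ℝ, Model m) x :=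
  (comps (chartAt (Model m) x) x).inverse ∘L
    mvfderiv 𝓘(ℝ, Model m) (fun q => comps (chartAt (Model m) x) q (Y q)) x

/-- The skew-symmetric product `X ∧_{∇⁰} Y`, defined by
`γ(Z, X ∧_{∇⁰} Y) = (1/2) [γ(X, ∇⁰_Z Y) - γ(Y, ∇⁰_Z X)]`. -/
def wedge [IsFlatParaKahler m M] (X Y : Π x : M, TangentSpace 𝓘(ℝ, Model m) x) (x : M) :
    TangentSpace 𝓘(ℝ, Model m) x :=
  sharp x ((1 / 2 : ℝ) •
    (metric x (X x) ∘ₗ (nabla Y x).toLinearMap - metric x (Y x) ∘ₗ (nabla X x).toLinearMap))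

/-- The metric `∇⁰`-bracket (C-bracket) `[X, Y]_{∇⁰} = ∇⁰_X Y - ∇⁰_Y X - X ∧_{∇⁰} Y`. -/
def metricBracket [IsFlatParaKahler m M] (X Y : Π x : M, TangentSpace 𝓘(ℝ, Model m) x) (x : M) :
    TangentSpace 𝓘(ℝ, Model m) x :=
  nabla Y x (X x) - nabla X x (Y x) - wedge X Y x

/-- The metric `∇⁰`-product `X ★_{∇⁰} Y = [X, Y]_{∇⁰} + ∂(γ(X, Y))`. -/
def star [IsFlatParaKahler m M] (X Y : Π x : M, TangentSpace 𝓘(ℝ, Model m) x) (x : M) :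
    TangentSpace 𝓘(ℝ, Model m) x :=
  metricBracket X Y x + partialOp (fun q => metric q (X q) (Y q)) x

/-- Smooth vector fields on `M`. -/
def IsSmoothField [IsFlatParaKahler m M] (X : Π x : M, TangentSpace 𝓘(ℝ, Model m) x) : Prop :=
  ContMDiff 𝓘(ℝ, Model m) 𝓘(ℝ, Model m).tangent ∞
    (fun x => (⟨x, X x⟩ : TangentBundle 𝓘(ℝ, Model m) M))

/-- Strongly foliated vector fields: smooth vector fields of the local form
`X = ξⁱ(xʲ) ∂/∂xⁱ + ξ̃ᵢ(xʲ) ∂/∂x̃ᵢ` with respect to distinguished coordinates. -/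
def IsStronglyFoliated [IsFlatParaKahler m M] (X : Π x : M, TangentSpace 𝓘(ℝ, Model m) x) : Prop :=
  IsSmoothField X ∧
    ∀ e ∈ atlas (Model m) M, ∀ x ∈ e.source,
      ∃ ξ ξ' : (Fin m → ℝ) → (Fin m → ℝ),
        ∀ᶠ q in 𝓝 x, comps e q (X q) = (ξ (e q).1, ξ' (e q).1)

/-- The left-hand side `X ★ (Y ★ Z) - (X ★ Y) ★ Z - Y ★ (X ★ Z)` of the Leibniz identity. -/
def leibnizDefect [IsFlatParaKahler m M] (X Y Z : Π x : M, TangentSpace 𝓘(ℝ, Model m) x) :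
    Π x : M, TangentSpace 𝓘(ℝ, Model m) x :=
  star X (star Y Z) - star (star X Y) Z - star Y (star X Z)

end ParaKahler

end

noncomputable section

namespace ParaKahler

variable {m : ℕ}

/-! In distinguished coordinates, where `∇⁰` is the ordinary derivative, half of the wedge term
cancels against half of `∂(γ(X, Y))`, leaving `F ★ G = DG(F) - DF(G) + (DF)*(G)`, with `*` the
adjoint for the neutral metric (`comps_star`). In the Leibniz defect all second derivatives cancel
by symmetry, and what remains is `DG((DF)* H) - DF((DG)* H) - DH((DF)* G)`
(`modelStar_leibniz_defect`). If the fields depend on the `xⁱ` only, their derivatives kill the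
vertical space spanned by the `∂/∂x̃ᵢ`. This space is its own orthogonal, so the adjoints take
values in it, and each of the three terms vanishes (`modelStar_leibniz`). For `F = H = id` and `G =
c` constant the same formula gives `-c`. A bump function carries this counterexample to `M`. -/

/-! ### Adjoints for the neutral metric. -/

lemma stdMetric_apply (u v : Model m) : stdMetric m u v = u.1 ⬝ᵥ v.2 + u.2 ⬝ᵥ v.1 := rfl

lemma stdMetric_comm (u v : Model m) : stdMetric m u v = stdMetric m v u := by
  rw [stdMetric_apply, stdMetric_apply, dotProduct_comm u.1, dotProduct_comm u.2, add_comm]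

lemma stdMetric_ext {u v : Model m} (h : ∀ w, stdMetric m u w = stdMetric m v w) : u = v :=
  LinearMap.ker_eq_bot.1 (LinearMap.separatingLeft_iff_ker_eq_bot.1 (stdMetric_nondegenerate m).1)
    (LinearMap.ext h)

/-- The adjoint of an endomorphism of the model space with respect to the neutral metric, as a
continuous linear function of the endomorphism. -/
def adj (m : ℕ) : (Model m →L[ℝ] Model m) →L[ℝ] (Model m →L[ℝ] Model m) :=
  let η := (stdMetric m).toDual (stdMetric_nondegenerate m)
  LinearMap.toContinuousLinearMap
    { toFun := fun T => LinearMap.toContinuousLinearMap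
        (η.symm.toLinearMap ∘ₗ T.toLinearMap.dualMap ∘ₗ η.toLinearMap)
      map_add' := fun S T => ContinuousLinearMap.ext fun u =>
        (congrArg η.symm (LinearMap.ext fun w => map_add (η u) (S w) (T w))).trans
          (map_add η.symm (η u ∘ₗ S.toLinearMap) (η u ∘ₗ T.toLinearMap))
      map_smul' := fun c T => ContinuousLinearMap.ext fun u =>
        (congrArg η.symm (LinearMap.ext fun w => map_smul (η u) c (T w))).trans
          (map_smul η.symm c (η u ∘ₗ T.toLinearMap)) }

lemma stdMetric_adj (T : Model m →L[ℝ] Model m) (u v : Model m) :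
    stdMetric m (adj m T u) v = stdMetric m u (T v) := by
  rw [← LinearMap.BilinForm.toDual_def (B := stdMetric m) (stdMetric_nondegenerate m)]
  simp [adj]
  rfl

lemma stdMetric_adj_right (T : Model m →L[ℝ] Model m) (u v : Model m) :
    stdMetric m u (adj m T v) = stdMetric m (T u) v := by
  rw [stdMetric_comm, stdMetric_adj, stdMetric_comm]

/-! ### The metric product on the model space. -/

/-- The metric product `X ★ Y` in distinguished coordinates. -/
def modelStar (F G : Model m → Model m) (p : Model m) : Model m :=
  fderiv ℝ G p (F p) - fderiv ℝ F p (G p) + adj m (fderiv ℝ F p) (G p)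

lemma contDiffAt_modelStar {F G : Model m → Model m} {p : Model m}
    (hF : ContDiffAt ℝ ∞ F p) (hG : ContDiffAt ℝ ∞ G p) :
    ContDiffAt ℝ ∞ (modelStar F G) p := by
  have hF' : ContDiffAt ℝ ∞ (fderiv ℝ F) p := hF.fderiv_right (by simp)
  have hG' : ContDiffAt ℝ ∞ (fderiv ℝ G) p := hG.fderiv_right (by simp)
  exact ((hG'.clm_apply hF).sub (hF'.clm_apply hG)).add
    (((adj m).contDiff.contDiffAt.comp p hF').clm_apply hG)

/-- The product is a first-order differential operator, so it sees only germs. This allows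
substitution inside nested products. -/
lemma modelStar_congr {F F' G G' : Model m → Model m} {p : Model m}
    (hF : F =ᶠ[𝓝 p] F') (hG : G =ᶠ[𝓝 p] G') : modelStar F G p = modelStar F' G' p := by
  simp only [modelStar, hF.fderiv_eq, hG.fderiv_eq, hF.eq_of_nhds, hG.eq_of_nhds]

lemma fderiv_modelStar {F G : Model m → Model m} {p : Model m}
    (hF : ContDiffAt ℝ ∞ F p) (hG : ContDiffAt ℝ ∞ G p) (u : Model m) :
    fderiv ℝ (modelStar F G) p u =
      fderiv ℝ (fderiv ℝ G) p u (F p) + fderiv ℝ G p (fderiv ℝ F p u)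
        - (fderiv ℝ (fderiv ℝ F) p u (G p) + fderiv ℝ F p (fderiv ℝ G p u))
        + (adj m (fderiv ℝ (fderiv ℝ F) p u) (G p) + adj m (fderiv ℝ F p) (fderiv ℝ G p u)) := by
  have dF : HasFDerivAt F (fderiv ℝ F p) p := (hF.differentiableAt (by simp)).hasFDerivAt
  have dG : HasFDerivAt G (fderiv ℝ G p) p := (hG.differentiableAt (by simp)).hasFDerivAt
  have dF' : HasFDerivAt (fderiv ℝ F) (fderiv ℝ (fderiv ℝ F) p) p :=
    ((hF.fderiv_right (m := ∞) (by simp)).differentiableAt (by simp)).hasFDerivAt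
  have dG' : HasFDerivAt (fderiv ℝ G) (fderiv ℝ (fderiv ℝ G) p) p :=
    ((hG.fderiv_right (m := ∞) (by simp)).differentiableAt (by simp)).hasFDerivAt
  have h := ((dG'.clm_apply dF).sub (dF'.clm_apply dG)).add
    (((adj m).hasFDerivAt.comp p dF').clm_apply dG)
  rw [show fderiv ℝ (modelStar F G) p = _ from h.fderiv]
  simp [add_comm]

lemma modelStar_leibniz_defect {F G H : Model m → Model m} {p : Model m}
    (hF : ContDiffAt ℝ ∞ F p) (hG : ContDiffAt ℝ ∞ G p) (hH : ContDiffAt ℝ ∞ H p) :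
    modelStar F (modelStar G H) p - modelStar (modelStar F G) H p - modelStar G (modelStar F H) p =
      fderiv ℝ G p (adj m (fderiv ℝ F p) (H p)) - fderiv ℝ F p (adj m (fderiv ℝ G p) (H p))
        - fderiv ℝ H p (adj m (fderiv ℝ F p) (G p)) := by
  have symm {K : Model m → Model m} (hK : ContDiffAt ℝ ∞ K p) (u v : Model m) :
      fderiv ℝ (fderiv ℝ K) p u v = fderiv ℝ (fderiv ℝ K) p v u :=
    (hK.isSymmSndFDerivAt (by simpa using WithTop.coe_le_coe.2 (le_top : (2 : ℕ∞) ≤ ⊤))).eq u v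
  refine stdMetric_ext fun w => ?_
  simp only [modelStar, map_add, map_sub, LinearMap.add_apply, LinearMap.sub_apply, stdMetric_adj,
    fderiv_modelStar hF hG, fderiv_modelStar hF hH, fderiv_modelStar hG hH, stdMetric_adj_right]
  -- After pairing with `w`, adjoints have moved across the metric; the second-derivative terms now
  -- match up to the order of differentiation.
  rw [symm hF w (G p), symm hF w (H p), symm hG w (F p), symm hF (G p) (H p), symm hG (F p) (H p),
    symm hH (F p) (G p), stdMetric_comm (fderiv ℝ (fderiv ℝ F) p (H p) w) (G p)]
  ring

/-! ### Fields depending on the `xⁱ` only. -/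

/-- No regularity of `ξ` is known, so the chain rule is applied to `F` along the vertical line
through `p`, on which `F` is locally constant. -/
lemma fderiv_comp_fst_vertical {F : Model m → Model m} {ξ : (Fin m → ℝ) → Model m} {p : Model m}
    (hF : ContDiffAt ℝ ∞ F p) (h : F =ᶠ[𝓝 p] fun q => ξ q.1) (v : Fin m → ℝ) :
    fderiv ℝ F p (0, v) = 0 := by
  have dF : HasFDerivAt F (fderiv ℝ F p) p := (hF.differentiableAt (by simp)).hasFDerivAt
  have hg : HasFDerivAt (fun t : ℝ => p + t • ((0, v) : Model m))
      ((1 : ℝ →L[ℝ] ℝ).smulRight ((0, v) : Model m)) 0 :=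
    ((hasFDerivAt_id (0 : ℝ)).smul_const ((0, v) : Model m)).const_add p
  have hg0 : Filter.Tendsto (fun t : ℝ => p + t • ((0, v) : Model m)) (𝓝 0) (𝓝 p) := by
    simpa using hg.continuousAt.tendsto
  have hc := HasFDerivAt.comp (g := F) 0 (by simpa using dF) hg
  have h0 : HasFDerivAt (F ∘ fun t : ℝ => p + t • ((0, v) : Model m)) (0 : ℝ →L[ℝ] Model m) 0 := by
    refine (hasFDerivAt_const (ξ p.1) (0 : ℝ)).congr_of_eventuallyEq ?_
    filter_upwards [hg0.eventually h] with t ht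
    rw [Function.comp_apply, ht]
    simp
  simpa using DFunLike.congr_fun (hc.unique h0) 1

/-- The image of the adjoint is orthogonal to the kernel of `T`, and the vertical space is its own
orthogonal. -/
lemma adj_fst_eq_zero {T : Model m →L[ℝ] Model m} (hT : ∀ v, T (0, v) = 0) (u : Model m) :
    (adj m T u).1 = 0 := by
  refine dotProduct_eq_zero _ fun v => ?_
  simpa [stdMetric_apply, hT] using stdMetric_adj T u (0, v)

/-- Both fields are invariant under vertical translations, and `fderiv` commutes with translations
even without differentiability. The base value `0` is an arbitrary choice. -/
lemma modelStar_comp_fst (ξ ζ : (Fin m → ℝ) → Model m) (q : Model m) :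
    modelStar (fun p => ξ p.1) (fun p => ζ p.1) q =
      modelStar (fun p => ξ p.1) (fun p => ζ p.1) (q.1, 0) := by
  have key (ξ : (Fin m → ℝ) → Model m) :
      fderiv ℝ (fun p : Model m => ξ p.1) q = fderiv ℝ (fun p : Model m => ξ p.1) (q.1, 0) := by
    have := fderiv_comp_add_right (𝕜 := ℝ) (f := fun p : Model m => ξ p.1) (x := (q.1, 0)) (0, q.2)
    simpa using this.symm
  simp only [modelStar, key]

lemma modelStar_eventuallyEq_comp_fst {F G : Model m → Model m} {ξ ζ : (Fin m → ℝ) → Model m}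
    {p : Model m} (hF : F =ᶠ[𝓝 p] fun q => ξ q.1) (hG : G =ᶠ[𝓝 p] fun q => ζ q.1) :
    modelStar F G =ᶠ[𝓝 p] fun q => modelStar (fun p => ξ p.1) (fun p => ζ p.1) (q.1, 0) := by
  filter_upwards [hF.eventuallyEq_nhds, hG.eventuallyEq_nhds] with q hFq hGq
  rw [modelStar_congr hFq hGq, modelStar_comp_fst]

lemma modelStar_leibniz {F G H : Model m → Model m} {ξ ζ χ : (Fin m → ℝ) → Model m} {p : Model m}
    (hF : ContDiffAt ℝ ∞ F p) (hG : ContDiffAt ℝ ∞ G p) (hH : ContDiffAt ℝ ∞ H p)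
    (hξ : F =ᶠ[𝓝 p] fun q => ξ q.1) (hζ : G =ᶠ[𝓝 p] fun q => ζ q.1)
    (hχ : H =ᶠ[𝓝 p] fun q => χ q.1) :
    modelStar F (modelStar G H) p - modelStar (modelStar F G) H p - modelStar G (modelStar F H) p =
      0 := by
  have vert {T : Model m →L[ℝ] Model m} (hT : ∀ v, T (0, v) = 0) (u : Model m) :
      adj m T u = (0, (adj m T u).2) := Prod.ext (adj_fst_eq_zero hT u) rfl
  have hF' := fderiv_comp_fst_vertical hF hξ
  have hG' := fderiv_comp_fst_vertical hG hζ
  have hH' := fderiv_comp_fst_vertical hH hχ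
  rw [modelStar_leibniz_defect hF hG hH, vert hF', vert hG', vert hF' (G p), hF', hG', hH']
  simp

/-! ### Passage between `M` and distinguished coordinates. -/

variable {M : Type*} [TopologicalSpace M] [ChartedSpace (Model m) M]
  {e : OpenPartialHomeomorph M (Model m)} {x : M}

/-- The components of a vector field, as a function of the distinguished coordinates `e`. -/
def rep (e : OpenPartialHomeomorph M (Model m)) (X : Π x : M, TangentSpace 𝓘(ℝ, Model m) x)
    (p : Model m) : Model m :=
  comps e (e.symm p) (X (e.symm p))

lemma rep_apply (X : Π x : M, TangentSpace 𝓘(ℝ, Model m) x) (hx : x ∈ e.source) :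
    rep e X (e x) = comps e x (X x) := by
  rw [rep, e.left_inv hx]

lemma eventuallyEq_comp_symm_comp {M H F : Type*} [TopologicalSpace M] [TopologicalSpace H]
    {e : OpenPartialHomeomorph M H} {x : M} (f : M → F)
    (hx : x ∈ e.source) :
    f =ᶠ[𝓝 x] (f ∘ e.symm) ∘ e := by
  filter_upwards [e.open_source.mem_nhds hx] with q hq
  simp [e.left_inv hq]

variable [IsFlatParaKahler m M]

lemma contMDiffAt_chart (he : e ∈ atlas (Model m) M) (hx : x ∈ e.source) :
    ContMDiffAt 𝓘(ℝ, Model m) 𝓘(ℝ, Model m) ∞ e x :=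
  contMDiffAt_of_mem_maximalAtlas (IsManifold.subset_maximalAtlas he) hx

lemma contMDiffAt_chart_symm (he : e ∈ atlas (Model m) M) (hx : x ∈ e.source) :
    ContMDiffAt 𝓘(ℝ, Model m) 𝓘(ℝ, Model m) ∞ e.symm (e x) :=
  contMDiffAt_symm_of_mem_maximalAtlas (IsManifold.subset_maximalAtlas he) (e.map_source hx)

section

variable {F : Type*} [NormedAddCommGroup F] [NormedSpace ℝ F]

lemma contMDiffAt_iff_comp_chart_symm (he : e ∈ atlas (Model m) M) (hx : x ∈ e.source) {f : M → F} :
    ContMDiffAt 𝓘(ℝ, Model m) 𝓘(ℝ, F) ∞ f x ↔ ContDiffAt ℝ ∞ (f ∘ e.symm) (e x) := by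
  constructor
  · intro hf
    exact (ContMDiffAt.comp (e x) (by rwa [e.left_inv hx])
      (contMDiffAt_chart_symm he hx)).contDiffAt
  · intro hf
    exact (hf.contMDiffAt.comp x (contMDiffAt_chart he hx)).congr_of_eventuallyEq
      (eventuallyEq_comp_symm_comp f hx)

lemma mvfderiv_comp_chart (he : e ∈ atlas (Model m) M) (hx : x ∈ e.source) {f : M → F}
    {g : Model m → F} (hg : DifferentiableAt ℝ g (e x)) (hfg : f =ᶠ[𝓝 x] g ∘ e) :
    mvfderiv 𝓘(ℝ, Model m) f x = fderiv ℝ g (e x) ∘L comps e x := by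
  have h1 : MDifferentiableAt 𝓘(ℝ, Model m) 𝓘(ℝ, Model m) e x :=
    (contMDiffAt_chart he hx).mdifferentiableAt (by simp)
  have h := (hg.hasFDerivAt.hasMFDerivAt.comp x h1.hasMFDerivAt).congr_of_eventuallyEq hfg
  rw [mvfderiv, h.mfderiv]
  rfl

lemma mvfderiv_eq (he : e ∈ atlas (Model m) M) (hx : x ∈ e.source) {f : M → F}
    (hf : ContDiffAt ℝ ∞ (f ∘ e.symm) (e x)) :
    mvfderiv 𝓘(ℝ, Model m) f x = fderiv ℝ (f ∘ e.symm) (e x) ∘L comps e x :=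
  mvfderiv_comp_chart he hx (hf.differentiableAt (by simp)) (eventuallyEq_comp_symm_comp f hx)

end

lemma comps_bijective (he : e ∈ atlas (Model m) M) (hx : x ∈ e.source) :
    Function.Bijective (comps e x) :=
  (mdifferentiable_of_mem_atlas (I := 𝓘(ℝ, Model m)) he).mfderiv_bijective hx

lemma isInvertible_comps_chartAt {q : M} (hq : q ∈ (chartAt (Model m) x).source) :
    (comps (chartAt (Model m) x) q).IsInvertible :=
  isInvertible_mfderiv_extChartAt (I := 𝓘(ℝ, Model m)) (by simpa using hq)

/-- The components of tangent vectors in two systems of distinguished coordinates are locally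
related by a constant isometry of the neutral metric. -/
lemma exists_comps_eq {e' : OpenPartialHomeomorph M (Model m)} (he : e ∈ atlas (Model m) M)
    (he' : e' ∈ atlas (Model m) M) (hx : x ∈ e.source) (hx' : x ∈ e'.source) :
    ∃ A : Model m →L[ℝ] Model m, (∀ u v, stdMetric m (A u) (A v) = stdMetric m u v) ∧
      ∀ᶠ q in 𝓝 x, comps e' q = A ∘L comps e q := by
  obtain ⟨α, β, α₀, β₀, hαβ, h⟩ := IsFlatParaKahler.affine_change e he e' he' (e x)
    (by simp [hx, hx'])
  let A : Model m →L[ℝ] Model m :=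
    (LinearMap.toContinuousLinearMap (Matrix.mulVecLin α)).prodMap
      (LinearMap.toContinuousLinearMap (Matrix.mulVecLin β))
  have hA (u : Model m) : A u = (α *ᵥ u.1, β *ᵥ u.2) := rfl
  -- The relation `αᵀ * β = 1` is exactly what makes `A` an isometry.
  have dot (v w : Fin m → ℝ) : (α *ᵥ v) ⬝ᵥ (β *ᵥ w) = v ⬝ᵥ w := by
    rw [Matrix.dotProduct_mulVec, Matrix.vecMul_mulVec, hαβ, Matrix.vecMul_one]
  refine ⟨A, fun u v => ?_, ?_⟩
  · rw [stdMetric_apply, stdMetric_apply, hA, hA, dot, dotProduct_comm (β *ᵥ u.2), dot,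
      dotProduct_comm v.1]
  · have h1 : ∀ᶠ q in 𝓝 x, e' q = A (e q) + (α₀, β₀) := by
      filter_upwards [(e.continuousAt hx).eventually h, e.open_source.mem_nhds hx] with q hq hqe
      simpa [e.left_inv hqe] using! hq
    filter_upwards [h1.eventually_nhds, e.open_source.mem_nhds hx] with q hq hqe
    rw [comps, mvfderiv_comp_chart he hqe (g := fun p => A p + (α₀, β₀)) (by fun_prop) hq]
    congr 1
    simp

lemma trivializationAt_snd (x : M) {q : M} (hq : q ∈ (chartAt (Model m) x).source)
    (v : TangentSpace 𝓘(ℝ, Model m) q) :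
    (trivializationAt (Model m) (TangentSpace 𝓘(ℝ, Model m)) x ⟨q, v⟩).2 =
      comps (chartAt (Model m) x) q v := by
  have h := DFunLike.congr_fun
    (TangentBundle.continuousLinearMapAt_trivializationAt (I := 𝓘(ℝ, Model m)) hq) v
  rw [Bundle.Trivialization.continuousLinearMapAt_apply,
    Bundle.Trivialization.linearMapAt_apply, if_pos (by simpa using hq)] at h
  exact h

/-- The bundle trivialization at `x` reads off components in the preferred chart; any other chart
changes them by a locally constant linear map. -/
lemma contMDiffAt_field_iff (X : Π x : M, TangentSpace 𝓘(ℝ, Model m) x)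
    (he : e ∈ atlas (Model m) M) (hx : x ∈ e.source) :
    ContMDiffAt 𝓘(ℝ, Model m) 𝓘(ℝ, Model m).tangent ∞
      (fun x => (⟨x, X x⟩ : TangentBundle 𝓘(ℝ, Model m) M)) x ↔
    ContDiffAt ℝ ∞ (rep e X) (e x) := by
  have key {e e' : OpenPartialHomeomorph M (Model m)} (he : e ∈ atlas (Model m) M)
      (he' : e' ∈ atlas (Model m) M) (hx : x ∈ e.source) (hx' : x ∈ e'.source)
      (h : ContMDiffAt 𝓘(ℝ, Model m) 𝓘(ℝ, Model m) ∞ (fun q => comps e q (X q)) x) :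
      ContMDiffAt 𝓘(ℝ, Model m) 𝓘(ℝ, Model m) ∞ (fun q => comps e' q (X q)) x := by
    obtain ⟨A, -, hA⟩ := exists_comps_eq he he' hx hx'
    refine (A.contDiff.contMDiff.contMDiffAt.comp x h).congr_of_eventuallyEq ?_
    filter_upwards [hA] with q hq
    rw [hq]
    rfl
  have hc : (fun q => (trivializationAt (Model m) (TangentSpace 𝓘(ℝ, Model m)) x ⟨q, X q⟩).2)
      =ᶠ[𝓝 x] fun q => comps (chartAt (Model m) x) q (X q) := by
    filter_upwards [(chartAt (Model m) x).open_source.mem_nhds (mem_chart_source _ x)] with q hq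
    exact trivializationAt_snd x hq _
  have hrep : rep e X = (fun q => comps e q (X q)) ∘ e.symm := rfl
  rw [hrep, ← contMDiffAt_iff_comp_chart_symm he hx]
  refine (Bundle.contMDiffAt_section x).trans (hc.contMDiffAt_iff.trans ⟨?_, ?_⟩)
  · exact key (chart_mem_atlas _ x) he (mem_chart_source _ x) hx
  · exact key he (chart_mem_atlas _ x) hx (mem_chart_source _ x)

lemma IsSmoothField.contDiffAt_rep {X : Π x : M, TangentSpace 𝓘(ℝ, Model m) x}
    (hX : IsSmoothField X) (he : e ∈ atlas (Model m) M) (hx : x ∈ e.source) :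
    ContDiffAt ℝ ∞ (rep e X) (e x) :=
  (contMDiffAt_field_iff X he hx).1 (hX x)

lemma metric_eq (he : e ∈ atlas (Model m) M) (hx : x ∈ e.source)
    (u v : TangentSpace 𝓘(ℝ, Model m) x) :
    metric x u v = stdMetric m (comps e x u) (comps e x v) := by
  obtain ⟨A, hA, h⟩ := exists_comps_eq (chart_mem_atlas _ x) he (mem_chart_source _ x) hx
  rw [h.self_of_nhds]
  exact (hA _ _).symm

lemma metric_sharp (φ : Module.Dual ℝ (TangentSpace 𝓘(ℝ, Model m) x))
    (v : TangentSpace 𝓘(ℝ, Model m) x) : metric x (sharp x φ) v = φ v :=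
  LinearMap.BilinForm.apply_toDual_symm_apply φ v

/-- `nabla` is defined through the preferred chart at `x`. The transition map `A` of components is
locally constant, so it commutes with differentiation and any chart gives the same connection. -/
lemma comps_nabla {Y : Π x : M, TangentSpace 𝓘(ℝ, Model m) x} (hY : IsSmoothField Y)
    (he : e ∈ atlas (Model m) M) (hx : x ∈ e.source) (v : TangentSpace 𝓘(ℝ, Model m) x) :
    comps e x (nabla Y x v) = fderiv ℝ (rep e Y) (e x) (comps e x v) := by
  have hc := chart_mem_atlas (Model m) x
  have hxc := mem_chart_source (Model m) x
  obtain ⟨A, -, h⟩ := exists_comps_eq hc he hxc hx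
  have hinv : (comps (chartAt (Model m) x) x).IsInvertible :=
    isInvertible_comps_chartAt hxc
  have h1 : comps (chartAt (Model m) x) x (nabla Y x v) =
      mvfderiv 𝓘(ℝ, Model m) (fun q => comps (chartAt (Model m) x) q (Y q)) x v :=
    hinv.self_apply_inverse _
  have hd : DifferentiableAt ℝ (rep (chartAt (Model m) x) Y) (chartAt (Model m) x x) :=
    (hY.contDiffAt_rep hc hxc).differentiableAt (by simp)
  have h2 : mvfderiv 𝓘(ℝ, Model m) (fun q => comps e q (Y q)) x =
      fderiv ℝ (A ∘ rep (chartAt (Model m) x) Y) (chartAt (Model m) x x) ∘L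
        comps (chartAt (Model m) x) x := by
    refine mvfderiv_comp_chart hc hxc (A.differentiableAt.comp _ hd) ?_
    filter_upwards [h, (chartAt (Model m) x).open_source.mem_nhds hxc] with q hq hqc
    rw [hq, Function.comp_apply, Function.comp_apply, rep_apply Y hqc]
    rfl
  have h3 : mvfderiv 𝓘(ℝ, Model m) (fun q => comps e q (Y q)) x =
      fderiv ℝ (rep e Y) (e x) ∘L comps e x := mvfderiv_eq he hx (hY.contDiffAt_rep he hx)
  have h4 : mvfderiv 𝓘(ℝ, Model m) (fun q => comps (chartAt (Model m) x) q (Y q)) x =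
      fderiv ℝ (rep (chartAt (Model m) x) Y) (chartAt (Model m) x x) ∘L
        comps (chartAt (Model m) x) x := mvfderiv_eq hc hxc (hY.contDiffAt_rep hc hxc)
  rw [fderiv_comp _ A.differentiableAt hd, A.fderiv, ContinuousLinearMap.comp_assoc, ← h4, h3] at h2
  have h5 : comps e x (nabla Y x v) = A (comps (chartAt (Model m) x) x (nabla Y x v)) :=
    DFunLike.congr_fun h.self_of_nhds _
  rw [h5, h1]
  exact (DFunLike.congr_fun h2 v).symm

/-- The coordinate expression of the metric product. -/
lemma comps_star {X Y : Π x : M, TangentSpace 𝓘(ℝ, Model m) x} (hX : IsSmoothField X)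
    (hY : IsSmoothField Y) (he : e ∈ atlas (Model m) M) (hx : x ∈ e.source) :
    comps e x (star X Y x) = modelStar (rep e X) (rep e Y) (e x) := by
  have hX' := hX.contDiffAt_rep he hx
  have hY' := hY.contDiffAt_rep he hx
  let B := (stdMetric m).toContinuousBilinearMap
  have hγ : (fun q => metric q (X q) (Y q)) =ᶠ[𝓝 x]
      (fun p => B (rep e X p) (rep e Y p)) ∘ e := by
    filter_upwards [e.open_source.mem_nhds hx] with q hq
    rw [metric_eq he hq, Function.comp_apply, rep_apply X hq, rep_apply Y hq]
    rfl
  have hd := B.hasFDerivAt_of_bilinear (hX'.differentiableAt (by simp)).hasFDerivAt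
    (hY'.differentiableAt (by simp)).hasFDerivAt
  refine stdMetric_ext fun w => ?_
  obtain ⟨w, rfl⟩ := (comps_bijective he hx).2 w
  have hp : stdMetric m (comps e x (partialOp (fun q => metric q (X q) (Y q)) x)) (comps e x w) =
      1 / 2 * (stdMetric m (rep e X (e x)) (fderiv ℝ (rep e Y) (e x) (comps e x w)) +
        stdMetric m (fderiv ℝ (rep e X) (e x) (comps e x w)) (rep e Y (e x))) := by
    rw [← metric_eq he hx, partialOp, map_smul, LinearMap.smul_apply, metric_sharp,
      mvfderiv_comp_chart he hx hd.differentiableAt hγ, hd.fderiv]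
    rfl
  have hw : stdMetric m (comps e x (wedge X Y x)) (comps e x w) =
      1 / 2 * (stdMetric m (rep e X (e x)) (fderiv ℝ (rep e Y) (e x) (comps e x w)) -
        stdMetric m (rep e Y (e x)) (fderiv ℝ (rep e X) (e x) (comps e x w))) := by
    rw [← metric_eq he hx, wedge, metric_sharp, rep_apply X hx, rep_apply Y hx,
      ← comps_nabla hX he hx, ← comps_nabla hY he hx, ← metric_eq he hx, ← metric_eq he hx]
    rfl
  rw [star, metricBracket, map_add, map_sub, map_sub, map_add, map_sub, map_sub,
    comps_nabla hY he hx, comps_nabla hX he hx, modelStar, map_add, map_sub, ← rep_apply X hx,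
    ← rep_apply Y hx]
  -- The `∇⁰Y` halves of `hp` and `hw` cancel, while the `∇⁰X` halves add up to the adjoint term.
  simp only [LinearMap.add_apply, LinearMap.sub_apply, hp, hw, stdMetric_adj]
  rw [stdMetric_comm (fderiv ℝ (rep e X) (e x) (comps e x w))]
  ring

lemma rep_star_eventuallyEq {X Y : Π x : M, TangentSpace 𝓘(ℝ, Model m) x} (hX : IsSmoothField X)
    (hY : IsSmoothField Y) (he : e ∈ atlas (Model m) M) (hx : x ∈ e.source) :
    rep e (star X Y) =ᶠ[𝓝 (e x)] modelStar (rep e X) (rep e Y) := by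
  filter_upwards [e.open_target.mem_nhds (e.map_source hx)] with p hp
  rw [rep, comps_star hX hY he (e.map_target hp), e.right_inv hp]

lemma IsSmoothField.star {X Y : Π x : M, TangentSpace 𝓘(ℝ, Model m) x} (hX : IsSmoothField X)
    (hY : IsSmoothField Y) : IsSmoothField (star X Y) := fun x => by
  have hc := chart_mem_atlas (Model m) x
  have hxc := mem_chart_source (Model m) x
  exact (contMDiffAt_field_iff _ hc hxc).2
    ((contDiffAt_modelStar (hX.contDiffAt_rep hc hxc) (hY.contDiffAt_rep hc hxc)).congr_of_eventuallyEq
      (rep_star_eventuallyEq hX hY hc hxc))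

lemma comps_leibnizDefect {X Y Z : Π x : M, TangentSpace 𝓘(ℝ, Model m) x} (hX : IsSmoothField X)
    (hY : IsSmoothField Y) (hZ : IsSmoothField Z) (he : e ∈ atlas (Model m) M) (hx : x ∈ e.source) :
    comps e x (leibnizDefect X Y Z x) =
      modelStar (rep e X) (modelStar (rep e Y) (rep e Z)) (e x)
        - modelStar (modelStar (rep e X) (rep e Y)) (rep e Z) (e x)
        - modelStar (rep e Y) (modelStar (rep e X) (rep e Z)) (e x) := by
  simp only [leibnizDefect, Pi.sub_apply, map_sub]
  rw [comps_star hX (hY.star hZ) he hx, comps_star (hX.star hY) hZ he hx,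
    comps_star hY (hX.star hZ) he hx,
    modelStar_congr .rfl (rep_star_eventuallyEq hY hZ he hx),
    modelStar_congr (rep_star_eventuallyEq hX hY he hx) .rfl,
    modelStar_congr .rfl (rep_star_eventuallyEq hX hZ he hx)]

/-! ### Strongly foliated fields on `M`. -/

lemma IsStronglyFoliated.exists_rep_eq {X : Π x : M, TangentSpace 𝓘(ℝ, Model m) x}
    (hX : IsStronglyFoliated X) (he : e ∈ atlas (Model m) M) (hx : x ∈ e.source) :
    ∃ ξ : (Fin m → ℝ) → Model m, rep e X =ᶠ[𝓝 (e x)] fun p => ξ p.1 := by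
  obtain ⟨ξ, ξ', h⟩ := hX.2 e he x hx
  refine ⟨fun a => (ξ a, ξ' a), ?_⟩
  have hs : Filter.Tendsto e.symm (𝓝 (e x)) (𝓝 x) := e.tendsto_symm hx
  filter_upwards [hs.eventually h, e.open_target.mem_nhds (e.map_source hx)] with p hp hpt
  rw [rep, hp, e.right_inv hpt]

lemma IsStronglyFoliated.star {X Y : Π x : M, TangentSpace 𝓘(ℝ, Model m) x}
    (hX : IsStronglyFoliated X) (hY : IsStronglyFoliated Y) : IsStronglyFoliated (star X Y) := by
  refine ⟨hX.1.star hY.1, fun e he x hx => ?_⟩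
  obtain ⟨ξ, hξ⟩ := hX.exists_rep_eq he hx
  obtain ⟨ζ, hζ⟩ := hY.exists_rep_eq he hx
  let χ : (Fin m → ℝ) → Model m := fun a => modelStar (fun p => ξ p.1) (fun p => ζ p.1) (a, 0)
  refine ⟨fun a => (χ a).1, fun a => (χ a).2, ?_⟩
  filter_upwards [(e.continuousAt hx).eventually (modelStar_eventuallyEq_comp_fst hξ hζ),
    e.open_source.mem_nhds hx] with q hq hqe
  rw [comps_star hX.1 hY.1 he hqe, hq]

lemma IsStronglyFoliated.leibnizDefect_eq_zero {X Y Z : Π x : M, TangentSpace 𝓘(ℝ, Model m) x}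
    (hX : IsStronglyFoliated X) (hY : IsStronglyFoliated Y) (hZ : IsStronglyFoliated Z) :
    leibnizDefect X Y Z = 0 := by
  funext x
  have hc := chart_mem_atlas (Model m) x
  have hxc := mem_chart_source (Model m) x
  obtain ⟨ξ, hξ⟩ := hX.exists_rep_eq hc hxc
  obtain ⟨ζ, hζ⟩ := hY.exists_rep_eq hc hxc
  obtain ⟨χ, hχ⟩ := hZ.exists_rep_eq hc hxc
  refine (comps_bijective hc hxc).1 ?_
  rw [comps_leibnizDefect hX.1 hY.1 hZ.1 hc hxc, Pi.zero_apply, map_zero]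
  exact modelStar_leibniz (hX.1.contDiffAt_rep hc hxc) (hY.1.contDiffAt_rep hc hxc)
    (hZ.1.contDiffAt_rep hc hxc) hξ hζ hχ

/-! ### Failure on general vector fields. -/

/-- Every smooth vector field of the model space is the local coordinate expression of a smooth
vector field of `M`. -/
lemma exists_isSmoothField_rep_eventuallyEq [T2Space M] (x : M) {g : Model m → Model m}
    (hg : ContDiff ℝ ∞ g) :
    ∃ X : Π x : M, TangentSpace 𝓘(ℝ, Model m) x, IsSmoothField X ∧
      rep (chartAt (Model m) x) X =ᶠ[𝓝 (chartAt (Model m) x x)] g := by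
  have hc := chart_mem_atlas (Model m) x
  have hxc := mem_chart_source (Model m) x
  let s : Π q : M, TangentSpace 𝓘(ℝ, Model m) q := fun q =>
    (comps (chartAt (Model m) x) q).inverse (g (chartAt (Model m) x q))
  have hs {p : Model m} (hp : p ∈ (chartAt (Model m) x).target) :
      rep (chartAt (Model m) x) s p = g p := by
    have hp' := (chartAt (Model m) x).map_target hp
    rw [rep, (isInvertible_comps_chartAt hp').self_apply_inverse,
      (chartAt (Model m) x).right_inv hp]
  -- `s` is meaningful only on the chart domain. The cutoff has support there, which uses the
  -- Hausdorff hypothesis, and equals `1` near `x`, so the germ at `x` is unchanged.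
  let f : SmoothBumpFunction 𝓘(ℝ, Model m) x := Classical.arbitrary _
  refine ⟨fun q => f q • s q, ?_, ?_⟩
  · refine ContMDiffOn.smul_section_of_tsupport (V := TangentSpace 𝓘(ℝ, Model m)) (s := s)
      f.contMDiff.contMDiffOn (chartAt (Model m) x).open_source f.tsupport_subset_chartAt_source
      fun q hq => ContMDiffAt.contMDiffWithinAt ((contMDiffAt_field_iff s hc hq).2 ?_)
    refine hg.contDiffAt.congr_of_eventuallyEq ?_
    filter_upwards [(chartAt (Model m) x).open_target.mem_nhds
      ((chartAt (Model m) x).map_source hq)] with p hp using hs hp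
  · have ht := (chartAt (Model m) x).tendsto_symm hxc
    filter_upwards [ht.eventually f.eventuallyEq_one, (chartAt (Model m) x).open_target.mem_nhds
      ((chartAt (Model m) x).map_source hxc)] with p hp hpt
    rw [← hs hpt, rep, rep, map_smul, hp, Pi.one_apply, one_smul]

lemma adj_id : adj m (ContinuousLinearMap.id ℝ (Model m)) = ContinuousLinearMap.id ℝ (Model m) :=
  ContinuousLinearMap.ext fun u => stdMetric_ext fun w => stdMetric_adj _ u w

/-- In suitable coordinates, the Leibniz defect of the radial field, a constant field and the radial
field is minus the constant field. -/
lemma exists_leibnizDefect_ne_zero [T2Space M] (hm : 1 ≤ m) (x : M) :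
    ∃ X Y Z : Π x : M, TangentSpace 𝓘(ℝ, Model m) x,
      IsSmoothField X ∧ IsSmoothField Y ∧ IsSmoothField Z ∧ leibnizDefect X Y Z ≠ 0 := by
  have hc := chart_mem_atlas (Model m) x
  have hxc := mem_chart_source (Model m) x
  obtain ⟨X, hX, hX'⟩ := exists_isSmoothField_rep_eventuallyEq (m := m) x (g := id) contDiff_id
  obtain ⟨Y, hY, hY'⟩ := exists_isSmoothField_rep_eventuallyEq (m := m) x
    (g := fun _ : Model m => ((fun _ => 1, 0) : Model m)) contDiff_const
  refine ⟨X, Y, X, hX, hY, hX, fun h => ?_⟩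
  have h1 := comps_leibnizDefect hX hY hX hc hxc
  rw [h, Pi.zero_apply, map_zero, modelStar_leibniz_defect (hX.contDiffAt_rep hc hxc)
    (hY.contDiffAt_rep hc hxc) (hX.contDiffAt_rep hc hxc), hX'.fderiv_eq, hY'.fderiv_eq,
    hY'.eq_of_nhds, fderiv_id, adj_id] at h1
  -- Since `1 ≤ m` there is a coordinate to look at, and there the defect is `-1`.
  have h2 := congrFun (congrArg Prod.fst h1) ⟨0, hm⟩
  simp at h2

end ParaKahler

end

theorem proposition3p1 (m : ℕ) (M : Type*) [TopologicalSpace M] [T2Space M]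
    [ChartedSpace (ParaKahler.Model m) M] [ParaKahler.IsFlatParaKahler m M] :
    (∀ X Y : Π x : M, TangentSpace 𝓘(ℝ, ParaKahler.Model m) x,
      ParaKahler.IsStronglyFoliated X → ParaKahler.IsStronglyFoliated Y →
        ParaKahler.IsStronglyFoliated (ParaKahler.star X Y)) ∧
    (∀ X Y Z : Π x : M, TangentSpace 𝓘(ℝ, ParaKahler.Model m) x,
      ParaKahler.IsStronglyFoliated X → ParaKahler.IsStronglyFoliated Y →
        ParaKahler.IsStronglyFoliated Z → ParaKahler.leibnizDefect X Y Z = 0) ∧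
    (1 ≤ m → Nonempty M →
      ∃ X Y Z : Π x : M, TangentSpace 𝓘(ℝ, ParaKahler.Model m) x,
        ParaKahler.IsSmoothField X ∧ ParaKahler.IsSmoothField Y ∧ ParaKahler.IsSmoothField Z ∧
          ParaKahler.leibnizDefect X Y Z ≠ 0) := by
  refine ⟨fun X Y hX hY => hX.star hY, fun X Y Z hX hY hZ => hX.leibnizDefect_eq_zero hY hZ, ?_⟩
  rintro hm ⟨x⟩
  exact ParaKahler.exists_leibnizDefect_ne_zero hm x
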